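/- Let $n\ge 0$, let $\Phi$ be an arbitrary set of primitive propositions, and let $\mathcal L^K_n(\Phi)$ (resp. $\mathcal L^X_n(\Phi)$, $\mathcal L^{K,X,A}_n(\Phi)$) be the set of formulas built from $\Phi$ and $\top$ with $\neg,\wedge$ and the unary operators $K_1,\dots,K_n$ (resp. $X_1,\dots,X_n$; all of $K_i,X_i,A_i$ for $1\le i\le n$). $\varphi\vee\psi$, $\varphi\Rightarrow\psi$, $\varphi\Leftrightarrow\psi$ abbreviate $\neg(\neg\varphi\wedge\neg\psi)$, $\neg\varphi\vee\psi$, $(\varphi\Rightarrow\psi)\wedge(\psi\Rightarrow\varphi)$. $\Phi_\varphi$ is the set of primitive propositions that appear in $\varphi$. **HMS structures.** An HMS structure over $\Phi$ consists of a set $\Sigma$ that is the disjoint union of sets $S_\Psi$ ($\Psi\subseteq\Phi$), maps $\mathcal K_i:\Sigma\to 2^\Sigma$ ($1\le i\le n$), a map $\pi:\Sigma\times\Phi\to\{0,\frac12,1\}$ such that for $s\in S_\Psi$, $\pi(s,p)\ne\frac12$ iff $p\in\Psi$, and surjections $\rho_{\Psi',\Psi}:S_{\Psi'}\to S_\Psi$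 ($\Psi\subseteq\Psi'$) such that $\rho_{\Psi_2,\Psi_1}(\rho_{\Psi_3,\Psi_2}(s))=\rho_{\Psi_3,\Psi_1}(s)$ for $\Psi_1\subseteq\Psi_2\subseteq\Psi_3$, $s\in S_{\Psi_3}$, and $\pi(\rho_{\Psi',\Psi}(s),p)=\pi(s,p)$ for all $s\in S_{\Psi'}$ and $p\in\Psi$. For $B\subseteq S_\Psi$ let $B^\uparrow=\bigcup_{\Psi'\supseteq\Psi}\rho_{\Psi',\Psi}^{-1}(B)$. The structure is *partitional*, i.e. in $\mathcal H_n^{ret}(\Phi)$, if for all $i$: (confinedness) if $s\in S_\Psi$ then $\mathcal K_i(s)\subseteq S_{\Psi'}$ for some $\Psi'\subseteq\Psi$; (generalized reflexivity) $s\in\mathcal K_i(s)^\uparrow$ for all $s$; (stationarity) $s'\in\mathcal K_i(s)$ implies $\mathcal K_i(s')=\mathcal K_i(s)$; (projections preserve knowledge) if $\Psi_1\subseteq\Psi_2\subseteq\Psi_3$, $s\in S_{\Psi_3}$, $\mathcal K_i(s)\subseteq S_{\Psi_2}$, then $\rho_{\Psi_2,\Psi_1}(\mathcal K_i(s))=\mathcal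 K_i(\rho_{\Psi_3,\Psi_1}(s))$; (projections preserve ignorance) if $\Psi\subseteq\Psi'$ and $s\in S_{\Psi'}$ then $\mathcal K_i(s)^\uparrow\subseteq\mathcal K_i(\rho_{\Psi',\Psi}(s))^\uparrow$. Truth of $\varphi\in\mathcal L^K_n(\Phi)$ at $s\in S_\Psi$: $\top$ is true; $p$ is true iff $\pi(s,p)=1$; $\varphi\wedge\psi$ iff both are; $K_i\varphi$ iff $\varphi$ is true at all $t\in\mathcal K_i(s)$; $\neg\varphi$ iff $\varphi$ is not true at $s$ and $\Phi_\varphi\subseteq\Psi$. $\varphi$ is *weakly valid* in $\mathcal H_n^{ret}(\Phi)$ if it is false (i.e. $\neg\varphi$ is true) at no state of any structure in $\mathcal H_n^{ret}(\Phi)$. **Awareness structures.** An awareness structure consists of a set $\Sigma$, $\pi:\Sigma\times\Phi\to\{0,1\}$, $\mathcal K_i:\Sigma\to2^\Sigma$, and sets $\mathcal A_i(s)\subseteq\mathcal L^{K,X,A}_n(\Phi)$ for $s\in\Sigma$, $1\le i\le n$. Truth is two-valued and classical, with $K_i\varphi$ true at $s$ iff $\varphi$ is true at all $t\in\mathcal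 K_i(s)$, $A_i\varphi$ true at $s$ iff $\varphi\in\mathcal A_i(s)$, and $X_i\varphi$ true iff $A_i\varphi$ and $K_i\varphi$ are. $\mathcal N_n^{ret,pd}(\Phi)$ is the class of those that are *partitional* (each $\mathcal K_i$ is reflexive, transitive and Euclidean) and *propositionally determined*: $\varphi\in\mathcal A_i(s)$ iff $\Phi_\varphi\subseteq\mathcal A_i(s)$, and $t\in\mathcal K_i(s)$ implies $\mathcal A_i(s)=\mathcal A_i(t)$. A formula is *valid* in the class if it is true at all states of all its members. **Axiom systems.** Write $\Box_i$ for $K_i$ (or for $X_i$) and let $A_i\varphi$ abbreviate $\Box_i\varphi\vee\Box_i\neg\Box_i\varphi$. All indices $i,j$ range over $1,\dots,n$. $\mathcal U_n$ (with $\Box_i=K_i$) and $\mathcal U_n^X$ (with $\Box_i=X_i$) have as axioms all substitution instances of propositional tautologies, $\Box_i\varphi\Rightarrow\varphi$, $\Box_i\varphi\Rightarrow\Box_i\Box_i\varphi$, $\Box_i(\varphi\wedge\psi)\Rightarrow\Box_i\varphi\wedge\Box_i\psi$, $\Box_i\varphi\wedge\Box_i\psi\Rightarrow\Box_i(\varphi\wedge\psi)$,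 $A_i\varphi\Leftrightarrow A_i\neg\varphi$, $A_i(\varphi\wedge\psi)\Rightarrow A_i\varphi\wedge A_i\psi$, $\Box_i\top$, $A_i\Box_j\varphi\Leftrightarrow A_i\varphi$, and as rules modus ponens and: from $\varphi\Leftrightarrow\psi$ infer $\Box_i\varphi\Leftrightarrow\Box_i\psi$, provided $\Phi_\varphi=\Phi_\psi$. $\mathrm{S5}_n^K$ (with $\Box_i=K_i$) and $\mathrm{S5}_n^X$ (with $\Box_i=X_i$) have as axioms all substitution instances of propositional tautologies, $\Box_i\varphi\Rightarrow A_i\varphi$, $\Box_i\varphi\wedge\Box_i(\varphi\Rightarrow\psi)\wedge A_i\psi\Rightarrow\Box_i\psi$, $\Box_i\varphi\Rightarrow\varphi$, $\Box_i\varphi\Rightarrow\Box_i\Box_i\varphi$, $\neg\Box_i\varphi\wedge A_i\varphi\Rightarrow\Box_i\neg\Box_i\varphi$, $A_i\top$, $A_i\neg\varphi\Leftrightarrow A_i\varphi$, $A_i(\varphi\wedge\psi)\Leftrightarrow A_i\varphi\wedge A_i\psi$, $A_i\Box_j\varphi\Leftrightarrow A_i\varphi$, $A_iA_j\varphi\Leftrightarrow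 A_i\varphi$, $A_i\varphi\Rightarrow\Box_iA_i\varphi$, and as rules modus ponens and: from $\varphi$ infer $A_i\varphi\Rightarrow\Box_i\varphi$. They may or may not also contain the irrelevance rule: if $\Phi_\varphi\neq\emptyset$ and $\Phi_\varphi\cap\Phi_\psi=\emptyset$, from $\neg A_i\varphi\Rightarrow\psi$ infer $\psi$; the claim below is made for both versions. **Corollary.** (a) $\mathcal U_n$ and $\mathrm{S5}_n^K$ are each sound and complete for weak validity of $\mathcal L^K_n(\Phi)$ in $\mathcal H_n^{ret}(\Phi)$: for every $\varphi\in\mathcal L^K_n(\Phi)$, $\varphi$ is provable in the system iff $\varphi$ is weakly valid in $\mathcal H_n^{ret}(\Phi)$. (b) $\mathcal U_n^X$ and $\mathrm{S5}_n^X$ are each sound and complete for validity of $\mathcal L^X_n(\Phi)$ in $\mathcal N_n^{ret,pd}(\Phi)$: for every $\varphi\in\mathcal L^X_n(\Phi)$, $\varphi$ is provable in the system iff $\varphi$ is valid in $\mathcal N_n^{ret,pd}(\Phi)$. -/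

import Mathlib

universe u

namespace Unawareness

/-! ### Languages -/

/-- Formulas over the primitive propositions `Φ`, closed under conjunction, negation and the unary
modal operators in `O`, with the primitive formula `⊤`. -/
inductive Fm (O : Type) (Φ : Type u) : Type u
  | top : Fm O Φ
  | atom (p : Φ) : Fm O Φ
  | neg (φ : Fm O Φ) : Fm O Φ
  | and (φ ψ : Fm O Φ) : Fm O Φ
  | op (o : O) (φ : Fm O Φ) : Fm O Φ

namespace Fm

variable {O O' : Type} {Φ : Type u}

/-- `φ ∨ ψ` abbreviates `¬(¬φ ∧ ¬ψ)`. -/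
def or (φ ψ : Fm O Φ) : Fm O Φ := neg (and (neg φ) (neg ψ))

/-- `φ ⇒ ψ` abbreviates `¬φ ∨ ψ`. -/
def imp (φ ψ : Fm O Φ) : Fm O Φ := or (neg φ) ψ

/-- `φ ⇔ ψ` abbreviates `(φ ⇒ ψ) ∧ (ψ ⇒ φ)`. -/
def iff (φ ψ : Fm O Φ) : Fm O Φ := and (imp φ ψ) (imp ψ φ)

/-- The set of primitive propositions that appear in a formula. -/
def prims : Fm O Φ → Set Φ
  | top => ∅
  | atom p => {p}
  | neg φ => prims φ
  | and φ ψ => prims φ ∪ prims ψ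
  | op _ φ => prims φ

/-- Renaming of the modal operators. -/
def mapOp (f : O → O') : Fm O Φ → Fm O' Φ
  | top => top
  | atom p => atom p
  | neg φ => neg (mapOp f φ)
  | and φ ψ => and (mapOp f φ) (mapOp f ψ)
  | op o φ => op (f o) (mapOp f φ)

/-- Substitution of formulas for the variables of a formula of propositional logic
(a formula without modal operators). -/
def subst {V : Type u} (σ : V → Fm O Φ) : Fm Empty V → Fm O Φ
  | top => top
  | atom x => σ x
  | neg α => neg (subst σ α)
  | and α β => and (subst σ α) (subst σ β)
  | op o _ => o.elim

/-- Truth of a formula of propositional logic under a valuation of its variables. -/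
def PropTrue {V : Type u} (v : V → Prop) : Fm Empty V → Prop
  | top => True
  | atom x => v x
  | neg α => ¬ PropTrue v α
  | and α β => PropTrue v α ∧ PropTrue v β
  | op o _ => o.elim

/-- `φ` is a substitution instance of a valid formula of propositional logic. -/
def IsTautologyInstance (φ : Fm O Φ) : Prop :=
  ∃ (V : Type u) (α : Fm Empty V) (σ : V → Fm O Φ), (∀ v : V → Prop, PropTrue v α) ∧ subst σ α = φ

end Fm

/-- The operators `K_1, …, K_n`. -/
inductive KOp (n : ℕ) : Type
  | K (i : Fin n) : KOp n

/-- The operators `X_1, …, X_n` (explicit knowledge). -/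
inductive XOp (n : ℕ) : Type
  | X (i : Fin n) : XOp n

/-- The operators `K_i` (implicit knowledge), `X_i` (explicit knowledge) and `A_i` (awareness). -/
inductive KXAOp (n : ℕ) : Type
  | K (i : Fin n) : KXAOp n
  | X (i : Fin n) : KXAOp n
  | A (i : Fin n) : KXAOp n

/-- The language `L^K_n(Φ)`. -/
abbrev LK (n : ℕ) (Φ : Type u) : Type u := Fm (KOp n) Φ

/-- The language `L^X_n(Φ)`. -/
abbrev LX (n : ℕ) (Φ : Type u) : Type u := Fm (XOp n) Φ

/-- The language `L^{K,X,A}_n(Φ)`. -/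
abbrev LKXA (n : ℕ) (Φ : Type u) : Type u := Fm (KXAOp n) Φ

/-- `X_i` as an operator of the larger language. -/
def XOp.toKXA {n : ℕ} : XOp n → KXAOp n
  | .X i => .X i

/-- The inclusion of `L^X_n(Φ)` in `L^{K,X,A}_n(Φ)`. -/
def LX.toLKXA {n : ℕ} {Φ : Type u} (φ : LX n Φ) : LKXA n Φ := φ.mapOp XOp.toKXA

/-! ### HMS structures -/

/-- The three truth values `0`, `1/2`, `1`. -/
inductive TV : Type
  | zero : TV
  | half : TV
  | one : TV

/-- An HMS structure for `n` agents over `Φ`. The state space is the union of the (necessarily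
disjoint) sets `S_Ψ = {s | vocab s = Ψ}`, for `Ψ ⊆ Φ`. For `Ψ ⊆ Ψ'`, the projection
`ρ_{Ψ',Ψ} : S_Ψ' → S_Ψ` is `proj Ψ' Ψ` restricted to `S_Ψ'`; all other values of `proj` are
irrelevant, and nothing below refers to them. -/
structure HMSStructure (n : ℕ) (Φ : Type u) : Type (u + 1) where
  State : Type u
  vocab : State → Set Φ
  poss : Fin n → State → Set State
  val : State → Φ → TV
  proj : Set Φ → Set Φ → State → State
  /-- A primitive proposition is defined at `s ∈ S_Ψ` iff it is in `Ψ`. -/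
  val_ne_half_iff : ∀ s p, val s p ≠ TV.half ↔ p ∈ vocab s
  /-- `ρ_{Ψ',Ψ}` maps `S_Ψ'` into `S_Ψ`. -/
  vocab_proj : ∀ Ψ' Ψ, Ψ ⊆ Ψ' → ∀ s, vocab s = Ψ' → vocab (proj Ψ' Ψ s) = Ψ
  /-- `ρ_{Ψ',Ψ}` maps `S_Ψ'` onto `S_Ψ`. -/
  proj_surj : ∀ Ψ' Ψ, Ψ ⊆ Ψ' → ∀ t, vocab t = Ψ → ∃ s, vocab s = Ψ' ∧ proj Ψ' Ψ s = t
  /-- Projecting from `Ψ₃` to `Ψ₂` and then to `Ψ₁` is projecting from `Ψ₃` to `Ψ₁`. -/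
  proj_proj : ∀ Ψ₃ Ψ₂ Ψ₁, Ψ₁ ⊆ Ψ₂ → Ψ₂ ⊆ Ψ₃ → ∀ s, vocab s = Ψ₃ →
    proj Ψ₂ Ψ₁ (proj Ψ₃ Ψ₂ s) = proj Ψ₃ Ψ₁ s
  /-- `ρ_{Ψ',Ψ}(s)` describes `s` in the smaller vocabulary: it agrees with `s` on the truth values
  of the primitive propositions in `Ψ`. -/
  val_proj : ∀ Ψ' Ψ, Ψ ⊆ Ψ' → ∀ s, vocab s = Ψ' → ∀ p ∈ Ψ, val (proj Ψ' Ψ s) p = val s p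

namespace HMSStructure

variable {n : ℕ} {Φ : Type u} (M : HMSStructure n Φ)

/-- The set `S_Ψ` of states. -/
def S (Ψ : Set Φ) : Set M.State := {s | M.vocab s = Ψ}

/-- For `B ⊆ S_Ψ`, the set `B^↑` is the union over `Ψ' ⊇ Ψ` of the preimages of `B` under
`ρ_{Ψ',Ψ}`. (The space `S_Ψ` is determined by `B` if `B` is non-empty, and `∅^↑ = ∅`.) -/
def up (B : Set M.State) : Set M.State :=
  {s | ∃ Ψ Ψ' : Set Φ, B ⊆ M.S Ψ ∧ Ψ ⊆ Ψ' ∧ s ∈ M.S Ψ' ∧ M.proj Ψ' Ψ s ∈ B}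

/-- Truth at a state; `¬φ` is true at `s ∈ S_Ψ` iff `φ` is not true at `s` and all the primitive
propositions in `φ` are in `Ψ`. -/
def Sat : LK n Φ → M.State → Prop
  | .top, _ => True
  | .atom p, s => M.val s p = TV.one
  | .neg φ, s => ¬ Sat φ s ∧ φ.prims ⊆ M.vocab s
  | .and φ ψ, s => Sat φ s ∧ Sat ψ s
  | .op (.K i) φ, s => ∀ t ∈ M.poss i s, Sat φ t

def Confinedness : Prop :=
  ∀ i Ψ, ∀ s ∈ M.S Ψ, ∃ Ψ' ⊆ Ψ, M.poss i s ⊆ M.S Ψ'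

def GeneralizedReflexivity : Prop :=
  ∀ i s, s ∈ M.up (M.poss i s)

/-- Stationarity, part (a). -/
def StationarityA : Prop :=
  ∀ i s, ∀ s' ∈ M.poss i s, M.poss i s' ⊆ M.poss i s

/-- Stationarity, part (b). -/
def StationarityB : Prop :=
  ∀ i s, ∀ s' ∈ M.poss i s, M.poss i s ⊆ M.poss i s'

def ProjectionsPreserveKnowledge : Prop :=
  ∀ i Ψ₁ Ψ₂ Ψ₃, Ψ₁ ⊆ Ψ₂ → Ψ₂ ⊆ Ψ₃ → ∀ s ∈ M.S Ψ₃, M.poss i s ⊆ M.S Ψ₂ →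
    M.proj Ψ₂ Ψ₁ '' M.poss i s = M.poss i (M.proj Ψ₃ Ψ₁ s)

def ProjectionsPreserveIgnorance : Prop :=
  ∀ i Ψ' Ψ, Ψ ⊆ Ψ' → ∀ s ∈ M.S Ψ', M.up (M.poss i s) ⊆ M.up (M.poss i (M.proj Ψ' Ψ s))

/-- The class of partitional HMS structures. -/
structure IsPartitional : Prop where
  confinedness : M.Confinedness
  projectionsPreserveKnowledge : M.ProjectionsPreserveKnowledge
  projectionsPreserveIgnorance : M.ProjectionsPreserveIgnorance
  generalizedReflexivity : M.GeneralizedReflexivity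
  stationarityA : M.StationarityA
  stationarityB : M.StationarityB

end HMSStructure

/-- A formula is weakly valid in the partitional HMS structures if it is false (that is, its
negation is true) at no state of any of them. -/
def WeaklyValid {n : ℕ} {Φ : Type u} (φ : LK n Φ) : Prop :=
  ∀ M : HMSStructure n Φ, M.IsPartitional → ∀ s : M.State, ¬ M.Sat (.neg φ) s

/-! ### Awareness structures -/

/-- An awareness structure for `n` agents over `Φ`. -/
structure AwarenessStructure (n : ℕ) (Φ : Type u) : Type (u + 1) where
  State : Type u
  val : State → Φ → Bool
  poss : Fin n → State → Set State
  aware : Fin n → State → Set (LKXA n Φ)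

namespace AwarenessStructure

variable {n : ℕ} {Φ : Type u} (M : AwarenessStructure n Φ)

/-- Truth at a state. -/
def Sat : LKXA n Φ → M.State → Prop
  | .top, _ => True
  | .atom p, s => M.val s p = true
  | .neg φ, s => ¬ Sat φ s
  | .and φ ψ, s => Sat φ s ∧ Sat ψ s
  | .op (.K i) φ, s => ∀ t ∈ M.poss i s, Sat φ t
  | .op (.A i) φ, s => φ ∈ M.aware i s
  | .op (.X i) φ, s => φ ∈ M.aware i s ∧ ∀ t ∈ M.poss i s, Sat φ t

/-- Awareness is generated by primitive propositions. -/
def PropositionallyGenerated : Prop :=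
  ∀ i s φ, φ ∈ M.aware i s ↔ ∀ p ∈ φ.prims, Fm.atom p ∈ M.aware i s

/-- Agents know what they are aware of. -/
def AgentsKnowAwareness : Prop :=
  ∀ i s, ∀ t ∈ M.poss i s, M.aware i s = M.aware i t

def PropositionallyDetermined : Prop :=
  M.PropositionallyGenerated ∧ M.AgentsKnowAwareness

/-- The possibility correspondences are reflexive, transitive and Euclidean. -/
structure IsPartitional : Prop where
  reflexive : ∀ i s, s ∈ M.poss i s
  transitive : ∀ i s, ∀ t ∈ M.poss i s, M.poss i t ⊆ M.poss i s
  euclidean : ∀ i s, ∀ t ∈ M.poss i s, M.poss i s ⊆ M.poss i t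

end AwarenessStructure

/-- Validity of a formula of `L^X_n(Φ)` in the partitional propositionally determined awareness
structures. -/
def AwarenessValid {n : ℕ} {Φ : Type u} (φ : LX n Φ) : Prop :=
  ∀ M : AwarenessStructure n Φ, M.IsPartitional → M.PropositionallyDetermined →
    ∀ s : M.State, M.Sat φ.toLKXA s

/-! ### Axiom systems

The systems are given once for a generic family `□_1, …, □_n` of knowledge operators (`box`), to be
instantiated by `K_1, …, K_n` or by `X_1, …, X_n`. -/

section Systems

variable {O : Type} {Φ : Type u} {n : ℕ}

/-- `A_i φ` abbreviates `□_i φ ∨ □_i ¬□_i φ`. -/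
def Aw (box : Fin n → O) (i : Fin n) (φ : Fm O Φ) : Fm O Φ :=
  .or (.op (box i) φ) (.op (box i) (.neg (.op (box i) φ)))

/-- Provability in the `n`-agent version of the Modica–Rustichini system. -/
inductive UProvable (box : Fin n → O) : Fm O Φ → Prop
  /-- Prop -/
  | prop (φ : Fm O Φ) : φ.IsTautologyInstance → UProvable box φ
  /-- T -/
  | axT (i : Fin n) (φ : Fm O Φ) : UProvable box (.imp (.op (box i) φ) φ)
  /-- 4 -/
  | ax4 (i : Fin n) (φ : Fm O Φ) :
      UProvable box (.imp (.op (box i) φ) (.op (box i) (.op (box i) φ)))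
  /-- M -/
  | axM (i : Fin n) (φ ψ : Fm O Φ) :
      UProvable box (.imp (.op (box i) (.and φ ψ)) (.and (.op (box i) φ) (.op (box i) ψ)))
  /-- C -/
  | axC (i : Fin n) (φ ψ : Fm O Φ) :
      UProvable box (.imp (.and (.op (box i) φ) (.op (box i) ψ)) (.op (box i) (.and φ ψ)))
  /-- A -/
  | axA (i : Fin n) (φ : Fm O Φ) : UProvable box (.iff (Aw box i φ) (Aw box i (.neg φ)))
  /-- AM -/
  | axAM (i : Fin n) (φ ψ : Fm O Φ) :
      UProvable box (.imp (Aw box i (.and φ ψ)) (.and (Aw box i φ) (Aw box i ψ)))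
  /-- N -/
  | axN (i : Fin n) : UProvable box (.op (box i) .top)
  /-- The multi-agent axiom `A_i □_j φ ⇔ A_i φ`. -/
  | axAK (i j : Fin n) (φ : Fm O Φ) :
      UProvable box (.iff (Aw box i (.op (box j) φ)) (Aw box i φ))
  /-- MP -/
  | mp (φ ψ : Fm O Φ) : UProvable box φ → UProvable box (.imp φ ψ) → UProvable box ψ
  /-- RE_sa -/
  | re (i : Fin n) (φ ψ : Fm O Φ) : φ.prims = ψ.prims → UProvable box (.iff φ ψ) →
      UProvable box (.iff (.op (box i) φ) (.op (box i) ψ))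

/-- Provability in the `n`-agent version of Halpern's S5 system for explicit knowledge and
awareness. The irrelevance rule is among the rules iff `irr` holds. -/
inductive S5Provable (box : Fin n → O) (irr : Prop) : Fm O Φ → Prop
  /-- Prop -/
  | prop (φ : Fm O Φ) : φ.IsTautologyInstance → S5Provable box irr φ
  /-- Explicit knowledge implies awareness. -/
  | axXA (i : Fin n) (φ : Fm O Φ) : S5Provable box irr (.imp (.op (box i) φ) (Aw box i φ))
  /-- `□_i φ ∧ □_i (φ ⇒ ψ) ∧ A_i ψ ⇒ □_i ψ` -/
  | axK (i : Fin n) (φ ψ : Fm O Φ) :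
      S5Provable box irr (.imp
        (.and (.and (.op (box i) φ) (.op (box i) (.imp φ ψ))) (Aw box i ψ)) (.op (box i) ψ))
  /-- `□_i φ ⇒ φ` -/
  | axT (i : Fin n) (φ : Fm O Φ) : S5Provable box irr (.imp (.op (box i) φ) φ)
  /-- `□_i φ ⇒ □_i □_i φ` -/
  | ax4 (i : Fin n) (φ : Fm O Φ) :
      S5Provable box irr (.imp (.op (box i) φ) (.op (box i) (.op (box i) φ)))
  /-- `¬□_i φ ∧ A_i φ ⇒ □_i ¬□_i φ` -/
  | ax5 (i : Fin n) (φ : Fm O Φ) :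
      S5Provable box irr (.imp (.and (.neg (.op (box i) φ)) (Aw box i φ))
        (.op (box i) (.neg (.op (box i) φ))))
  /-- `A_i ⊤` -/
  | axATop (i : Fin n) : S5Provable box irr (Aw box i .top)
  /-- `A_i ¬φ ⇔ A_i φ` -/
  | axANeg (i : Fin n) (φ : Fm O Φ) : S5Provable box irr (.iff (Aw box i (.neg φ)) (Aw box i φ))
  /-- `A_i (φ ∧ ψ) ⇔ A_i φ ∧ A_i ψ` -/
  | axAAnd (i : Fin n) (φ ψ : Fm O Φ) :
      S5Provable box irr (.iff (Aw box i (.and φ ψ)) (.and (Aw box i φ) (Aw box i ψ)))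
  /-- `A_i □_j φ ⇔ A_i φ` -/
  | axAK (i j : Fin n) (φ : Fm O Φ) :
      S5Provable box irr (.iff (Aw box i (.op (box j) φ)) (Aw box i φ))
  /-- `A_i A_j φ ⇔ A_i φ` -/
  | axAA (i j : Fin n) (φ : Fm O Φ) :
      S5Provable box irr (.iff (Aw box i (Aw box j φ)) (Aw box i φ))
  /-- `A_i φ ⇒ □_i A_i φ` -/
  | axKA (i : Fin n) (φ : Fm O Φ) :
      S5Provable box irr (.imp (Aw box i φ) (.op (box i) (Aw box i φ)))
  /-- MP -/
  | mp (φ ψ : Fm O Φ) :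
      S5Provable box irr φ → S5Provable box irr (.imp φ ψ) → S5Provable box irr ψ
  /-- From `φ` infer `A_i φ ⇒ □_i φ`. -/
  | gen (i : Fin n) (φ : Fm O Φ) :
      S5Provable box irr φ → S5Provable box irr (.imp (Aw box i φ) (.op (box i) φ))
  /-- Irrelevance: if `φ` contains a primitive proposition and no primitive proposition in `φ`
  appears in `ψ`, from `¬A_i φ ⇒ ψ` infer `ψ`. -/
  | irrel (i : Fin n) (φ ψ : Fm O Φ) : irr → φ.prims.Nonempty → Disjoint φ.prims ψ.prims →
      S5Provable box irr (.imp (.neg (Aw box i φ)) ψ) → S5Provable box irr ψ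

/-- A set of theorems is sound and complete for a notion of validity of formulas of a language. -/
def SoundAndComplete {L : Type u} (provable valid : L → Prop) : Prop :=
  (∀ φ, provable φ → valid φ) ∧ (∀ φ, valid φ → provable φ)

end Systems

end Unawareness

namespace Unawareness

/-! ### Propositional reasoning -/

/-! Both kinds of structure reduce to one semantics, `AwModel`: equivalence relations, plus for each
agent and state a set of primitive propositions the agent is aware of, constant on classes. A box
means explicit knowledge: awareness of the formula's primitives and truth throughout the class.

Awareness structures translate directly. In an HMS structure, states with equal possibility sets are
made indistinguishable; conversely, each Kripke state is paired with every vocabulary it can be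
restricted to. Weak validity disregards states where the formula is undefined, and elsewhere the two
notions of truth agree (`sat_toAwModel`, `sat_toHMS`).

Both systems are sound for `AwModel`. S5 without irrelevance is complete by a canonical model whose
states are maximal consistent sets with a vocabulary attached (`sat_canonical`): the witness for a
failed box may be aware of too much, and shrinking its vocabulary repairs this. Every S5 theorem is
a theorem of U (`S5Provable.toU`), so U is complete too. Irrelevance is sound, so adding it changes
nothing. -/

/-- Predicates on formulas that respect the propositional connectives. -/
structure IsPropEval {O : Type} {Φ : Type u} (e : Fm O Φ → Prop) : Prop where
  top : e .top
  neg : ∀ φ, e (.neg φ) ↔ ¬ e φ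
  and : ∀ φ ψ, e (.and φ ψ) ↔ e φ ∧ e ψ

section Propositional

variable {O : Type} {Φ : Type u} {n : ℕ} {e : Fm O Φ → Prop}

theorem IsPropEval.or (h : IsPropEval e) (φ ψ : Fm O Φ) : e (.or φ ψ) ↔ e φ ∨ e ψ := by
  simp only [Fm.or, h.neg, h.and]; tauto

theorem IsPropEval.imp (h : IsPropEval e) (φ ψ : Fm O Φ) : e (.imp φ ψ) ↔ (e φ → e ψ) := by
  simp only [Fm.imp, h.or, h.neg]; tauto

theorem IsPropEval.iff (h : IsPropEval e) (φ ψ : Fm O Φ) : e (.iff φ ψ) ↔ (e φ ↔ e ψ) := by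
  simp only [Fm.iff, h.and, h.imp]; tauto

theorem IsPropEval.aw (h : IsPropEval e) (box : Fin n → O) (i : Fin n) (φ : Fm O Φ) :
    e (Aw box i φ) ↔ e (.op (box i) φ) ∨ e (.op (box i) (.neg (.op (box i) φ))) :=
  h.or _ _

namespace Fm

@[simp] theorem prims_top : (top : Fm O Φ).prims = ∅ := rfl
@[simp] theorem prims_atom (p : Φ) : (atom p : Fm O Φ).prims = {p} := rfl
@[simp] theorem prims_neg (φ : Fm O Φ) : (neg φ).prims = φ.prims := rfl
@[simp] theorem prims_and (φ ψ : Fm O Φ) : (and φ ψ).prims = φ.prims ∪ ψ.prims := rfl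
@[simp] theorem prims_op (o : O) (φ : Fm O Φ) : (op o φ).prims = φ.prims := rfl
@[simp] theorem prims_or (φ ψ : Fm O Φ) : (or φ ψ).prims = φ.prims ∪ ψ.prims := rfl
@[simp] theorem prims_imp (φ ψ : Fm O Φ) : (imp φ ψ).prims = φ.prims ∪ ψ.prims := rfl

@[simp] theorem prims_aw (box : Fin n → O) (i : Fin n) (φ : Fm O Φ) :
    (Aw box i φ).prims = φ.prims := by
  simp [Aw]

@[simp] theorem prims_mapOp {O' : Type} (f : O → O') (φ : Fm O Φ) :
    (φ.mapOp f).prims = φ.prims := by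
  induction φ <;> simp_all [mapOp]

/-- The propositional skeleton of a formula, with atoms and modal formulas as variables. -/
def skeleton : Fm O Φ → Fm Empty (Fm O Φ)
  | top => top
  | atom p => atom (atom p)
  | neg φ => neg (skeleton φ)
  | and φ ψ => and (skeleton φ) (skeleton ψ)
  | op o φ => atom (op o φ)

theorem subst_skeleton (φ : Fm O Φ) : subst id (skeleton φ) = φ := by
  induction φ <;> simp_all [skeleton, subst]

/-- Formulas themselves serve as the propositional variables, so every valuation of the skeleton is
a propositional evaluation. This lets `tauto` replace Hilbert-style derivations below. -/
theorem isTautologyInstance_of_eval {φ : Fm O Φ}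
    (h : ∀ e : Fm O Φ → Prop, IsPropEval e → e φ) : φ.IsTautologyInstance :=
  ⟨Fm O Φ, skeleton φ, id, fun v => h (fun ψ => PropTrue v (skeleton ψ))
    ⟨trivial, fun _ => Iff.rfl, fun _ _ => Iff.rfl⟩, subst_skeleton φ⟩

theorem eval_subst (he : IsPropEval e) {V : Type u} (σ : V → Fm O Φ) (α : Fm Empty V) :
    e (subst σ α) ↔ PropTrue (fun x => e (σ x)) α := by
  induction α with
  | top => simpa [subst, PropTrue] using he.top
  | atom x => rfl
  | neg α ih => simp [subst, PropTrue, he.neg, ih]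
  | and α β ih₁ ih₂ => simp [subst, PropTrue, he.and, ih₁, ih₂]
  | op o => exact o.elim

theorem IsTautologyInstance.eval {φ : Fm O Φ} (h : φ.IsTautologyInstance) (he : IsPropEval e) :
    e φ := by
  obtain ⟨V, α, σ, hα, rfl⟩ := h
  exact (eval_subst he σ α).2 (hα _)

end Fm

/-- Sets of formulas that contain the tautologies and are closed under modus ponens. -/
structure IsTheory (T : Fm O Φ → Prop) : Prop where
  taut : ∀ φ : Fm O Φ, (∀ e : Fm O Φ → Prop, IsPropEval e → e φ) → T φ
  mp : ∀ φ ψ, T φ → T (.imp φ ψ) → T ψ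

namespace IsTheory

variable {T : Fm O Φ → Prop} (hT : IsTheory T)
include hT

theorem cons₁ {φ ψ : Fm O Φ} (h : ∀ e : Fm O Φ → Prop, IsPropEval e → e φ → e ψ) (h₁ : T φ) :
    T ψ :=
  hT.mp _ _ h₁ (hT.taut _ fun e he => (he.imp _ _).2 (h e he))

theorem cons₂ {φ₁ φ₂ ψ : Fm O Φ}
    (h : ∀ e : Fm O Φ → Prop, IsPropEval e → e φ₁ → e φ₂ → e ψ) (h₁ : T φ₁) (h₂ : T φ₂) : T ψ :=
  hT.mp _ _ h₂ (hT.cons₁ (fun e he h₁ => (he.imp _ _).2 (h e he h₁)) h₁)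

theorem cons₃ {φ₁ φ₂ φ₃ ψ : Fm O Φ}
    (h : ∀ e : Fm O Φ → Prop, IsPropEval e → e φ₁ → e φ₂ → e φ₃ → e ψ)
    (h₁ : T φ₁) (h₂ : T φ₂) (h₃ : T φ₃) : T ψ :=
  hT.mp _ _ h₃ (hT.cons₂ (fun e he h₁ h₂ => (he.imp _ _).2 (h e he h₁ h₂)) h₁ h₂)

theorem cons₄ {φ₁ φ₂ φ₃ φ₄ ψ : Fm O Φ}
    (h : ∀ e : Fm O Φ → Prop, IsPropEval e → e φ₁ → e φ₂ → e φ₃ → e φ₄ → e ψ)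
    (h₁ : T φ₁) (h₂ : T φ₂) (h₃ : T φ₃) (h₄ : T φ₄) : T ψ :=
  hT.mp _ _ h₄ (hT.cons₃ (fun e he h₁ h₂ h₃ => (he.imp _ _).2 (h e he h₁ h₂ h₃)) h₁ h₂ h₃)

/-- Lindenbaum's lemma. -/
theorem exists_eval {φ : Fm O Φ} (hφ : ¬ T φ) :
    ∃ e : Fm O Φ → Prop, IsPropEval e ∧ (∀ ψ, T ψ → e ψ) ∧ ¬ e φ := by
  obtain ⟨M, hTM, hM⟩ := zorn_subset_nonempty
    -- Zorn's lemma on theories omitting `φ`; closure under the modal rules is deliberately not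
    -- demanded.
    {U : Set (Fm O Φ) | IsTheory (· ∈ U) ∧ φ ∉ U} (by
      intro c hc hchain hne
      refine ⟨⋃₀ c, ⟨⟨fun ψ h => ?_, fun ψ χ h₁ h₂ => ?_⟩, ?_⟩, fun U hU =>
        Set.subset_sUnion_of_mem hU⟩
      · obtain ⟨U, hU⟩ := hne
        exact ⟨U, hU, (hc hU).1.taut ψ h⟩
      · obtain ⟨U₁, hU₁, h₁⟩ := h₁
        obtain ⟨U₂, hU₂, h₂⟩ := h₂
        rcases hchain.total hU₁ hU₂ with h | h
        · exact ⟨U₂, hU₂, (hc hU₂).1.mp _ _ (h h₁) h₂⟩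
        · exact ⟨U₁, hU₁, (hc hU₁).1.mp _ _ h₁ (h h₂)⟩
      · rintro ⟨U, hU, h⟩
        exact (hc hU).2 h) {ψ | T ψ} ⟨hT, hφ⟩
  have hMT : IsTheory (· ∈ M) := hM.prop.1
  have hMφ : φ ∉ M := hM.prop.2
  -- The formulas implied by `ψ` modulo `M` form a theory that extends `M` and contains `ψ`. If it
  -- omitted `φ`, maximality would put `ψ` in `M`.
  have key : ∀ ψ, ψ ∉ M → Fm.imp ψ φ ∈ M := by
    intro ψ hψ
    by_contra hcon
    have hsub : M ⊆ {χ | Fm.imp ψ χ ∈ M} := fun χ hχ =>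
      hMT.cons₁ (fun e he h => (he.imp _ _).2 fun _ => h) hχ
    have hle := hM.le_of_ge (y := {χ | Fm.imp ψ χ ∈ M})
      ⟨⟨fun χ h => ?_, fun χ ξ h₁ h₂ => ?_⟩, hcon⟩ hsub
    · exact hψ (hle (hMT.taut _ fun e he => (he.imp _ _).2 id))
    · exact hMT.taut _ fun e he => (he.imp _ _).2 fun _ => h e he
    · exact hMT.cons₂ (fun e he => by simp only [he.imp]; tauto) h₁ h₂
  refine ⟨(· ∈ M), ⟨hMT.taut _ fun e he => he.top, fun ψ => ⟨fun h₁ h₂ => ?_, fun h => ?_⟩,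
    fun ψ χ => ⟨fun h => ⟨?_, ?_⟩, fun h => ?_⟩⟩, fun ψ h => hTM h, hMφ⟩
  · exact hMφ (hMT.cons₂ (fun e he => by simp only [he.neg]; tauto) h₁ h₂)
  · by_contra h'
    exact hMφ (hMT.cons₂ (fun e he => by simp only [he.imp, he.neg]; tauto) (key _ h) (key _ h'))
  · exact hMT.cons₁ (fun e he => by simp only [he.and]; tauto) h
  · exact hMT.cons₁ (fun e he => by simp only [he.and]; tauto) h
  · exact hMT.cons₂ (fun e he => by simp only [he.and]; tauto) h.1 h.2

end IsTheory

end Propositional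

/-! ### The two axiom systems -/

section Systems

variable {O : Type} {Φ : Type u} {n : ℕ} {box : Fin n → O}

theorem UProvable.isTheory (box : Fin n → O) : IsTheory (UProvable (Φ := Φ) box) :=
  ⟨fun _ h => .prop _ (Fm.isTautologyInstance_of_eval h), .mp⟩

theorem S5Provable.isTheory (box : Fin n → O) (irr : Prop) :
    IsTheory (S5Provable (Φ := Φ) box irr) :=
  ⟨fun _ h => .prop _ (Fm.isTautologyInstance_of_eval h), .mp⟩

theorem S5Provable.mono {irr irr' : Prop} (h : irr → irr') {φ : Fm O Φ}
    (hφ : S5Provable box irr φ) : S5Provable box irr' φ := by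
  induction hφ with
  | prop φ h => exact .prop φ h
  | axXA i φ => exact .axXA i φ
  | axK i φ ψ => exact .axK i φ ψ
  | axT i φ => exact .axT i φ
  | ax4 i φ => exact .ax4 i φ
  | ax5 i φ => exact .ax5 i φ
  | axATop i => exact .axATop i
  | axANeg i φ => exact .axANeg i φ
  | axAAnd i φ ψ => exact .axAAnd i φ ψ
  | axAK i j φ => exact .axAK i j φ
  | axAA i j φ => exact .axAA i j φ
  | axKA i φ => exact .axKA i φ
  | mp φ ψ _ _ h₁ h₂ => exact .mp φ ψ h₁ h₂
  | gen i φ _ h₁ => exact .gen i φ h₁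
  | irrel i φ ψ hi h₁ h₂ _ h₃ => exact .irrel i φ ψ (h hi) h₁ h₂ h₃

namespace UProvable

/-- A theorem in the vocabulary of `φ` is known iff the agent is aware of `φ`. -/
theorem aw_iff_box {φ τ : Fm O Φ} (i : Fin n) (hp : φ.prims = τ.prims) (hτ : UProvable box τ) :
    UProvable box (.iff (Aw box i φ) (.op (box i) τ)) := by
  have hT := UProvable.isTheory (Φ := Φ) box
  -- As `τ` is provable, `χ` is equivalent to `χ ∧ τ` in the same vocabulary, so the replacement
  -- rule applies.
  have k (χ : Fm O Φ) (hχ : χ.prims = τ.prims) :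
      UProvable box (.imp (.op (box i) χ) (.op (box i) τ)) := by
    have h₁ : UProvable box (.iff χ (.and χ τ)) :=
      hT.cons₁ (fun e he => by simp only [he.iff, he.and]; tauto) hτ
    exact hT.cons₂ (fun e he => by simp only [he.iff, he.and, he.imp]; tauto)
      (re i _ _ (by simp [hχ]) h₁) (axM i χ τ)
  have h₂ : UProvable box (.iff τ (.or φ (.neg φ))) :=
    hT.cons₁ (fun e he => by simp only [he.iff, he.or, he.neg]; tauto) hτ
  have h₃ : UProvable box (.imp (.op (box i) τ) (Aw box i (.or φ (.neg φ)))) :=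
    hT.cons₁ (fun e he => by simp only [he.iff, he.aw, he.imp]; tauto)
      (re i _ _ (by simp [hp]) h₂)
  -- The disjunction is a negated conjunction: A removes the outer negation, AM splits the
  -- conjunction, A removes the inner negation.
  have h₄ : UProvable box (.imp (Aw box i (.or φ (.neg φ))) (Aw box i φ)) :=
    hT.cons₃ (fun e he => by simp only [he.iff, he.and, he.imp, Fm.or]; tauto)
      (axA i (.and (.neg φ) (.neg (.neg φ)))) (axAM i (.neg φ) (.neg (.neg φ))) (axA i φ)
  exact hT.cons₄ (fun e he => by simp only [he.iff, he.aw, he.imp]; tauto)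
    (k φ hp) (k (.neg (.op (box i) φ)) hp) h₃ h₄

/-- Both sides are equivalent to knowing `φ ∨ ¬φ`. The S5 axioms on awareness of negations, boxes
and nested awareness are instances. -/
theorem aw_congr {φ ψ : Fm O Φ} (i : Fin n) (hp : φ.prims = ψ.prims) :
    UProvable box (.iff (Aw box i φ) (Aw box i ψ)) := by
  have hT := UProvable.isTheory (Φ := Φ) box
  have hτ : UProvable box (.or φ (.neg φ)) :=
    hT.taut _ fun e he => by simp only [he.or, he.neg]; tauto
  exact hT.cons₂ (fun e he => by simp only [he.iff]; tauto)
    (aw_iff_box (φ := φ) i (by simp) hτ) (aw_iff_box (φ := ψ) i (by simp [hp]) hτ)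

end UProvable

/-- Transfers completeness from S5 to U. Awareness is treated throughout as knowledge of a theorem
in the same vocabulary (`aw_iff_box`). -/
theorem S5Provable.toU {φ : Fm O Φ} (h : S5Provable box False φ) : UProvable box φ := by
  have hT := UProvable.isTheory (Φ := Φ) box
  induction h with
  | prop φ h => exact .prop φ h
  | axXA i φ => exact hT.taut _ fun e he => by simp only [he.imp, he.aw]; tauto
  | axK i φ ψ =>
    -- The conjunct `φ` stays on the right so that both sides have the same primitives.
    have h : UProvable box (.iff (.and φ (.imp φ ψ)) (.and ψ φ)) :=
      hT.taut _ fun e he => by simp only [he.iff, he.and, he.imp]; tauto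
    exact hT.cons₃ (fun e he => by simp only [he.iff, he.and, he.imp]; tauto)
      (.axC i φ (.imp φ ψ)) (.re i _ _ (by ext; simp; tauto) h) (.axM i ψ φ)
  | axT i φ => exact .axT i φ
  | ax4 i φ => exact .ax4 i φ
  | ax5 i φ => exact hT.taut _ fun e he => by simp only [he.imp, he.aw, he.and, he.neg]; tauto
  | axATop i => exact hT.cons₁ (fun e he => by simp only [he.aw]; tauto) (.axN i)
  | axANeg i φ => exact UProvable.aw_congr i (by simp)
  | axAAnd i φ ψ =>
    have hτ (φ : Fm O Φ) : UProvable box (.or φ (.neg φ)) :=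
      hT.taut _ fun e he => by simp only [he.or, he.neg]; tauto
    have hφψ : UProvable box (.and (.or φ (.neg φ)) (.or ψ (.neg ψ))) :=
      hT.cons₂ (fun e he => by simp only [he.and]; tauto) (hτ φ) (hτ ψ)
    have h := hT.cons₂ (ψ := .imp (.and (Aw box i φ) (Aw box i ψ))
        (.and (.op (box i) (.or φ (.neg φ))) (.op (box i) (.or ψ (.neg ψ)))))
      (fun e he => by simp only [he.and, he.imp, he.iff]; tauto)
      (UProvable.aw_iff_box i (φ := φ) (by simp) (hτ φ))
      (UProvable.aw_iff_box i (φ := ψ) (by simp) (hτ ψ))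
    exact hT.cons₄ (fun e he => by simp only [he.and, he.imp, he.iff]; tauto) h
      (.axC i _ _) (UProvable.aw_iff_box i (φ := .and φ ψ) (by simp) hφψ) (.axAM i φ ψ)
  | axAK i j φ => exact UProvable.aw_congr i (by simp)
  | axAA i j φ => exact UProvable.aw_congr i (by simp)
  | axKA i φ =>
    have h := UProvable.aw_iff_box (box := box) i (φ := φ) (τ := .or φ (.neg φ)) (by simp)
      (hT.taut _ fun e he => by simp only [he.or, he.neg]; tauto)
    exact hT.cons₃ (fun e he => by simp only [he.imp, he.iff]; tauto) h
      (.ax4 i (.or φ (.neg φ))) (.re i _ _ (by simp) h)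
  | mp φ ψ _ _ h₁ h₂ => exact .mp φ ψ h₁ h₂
  | gen i φ _ h =>
    exact hT.cons₁ (fun e he => by simp only [he.imp, he.iff]; tauto)
      (UProvable.aw_iff_box i rfl h)
  | irrel _ _ _ hi => exact hi.elim

end Systems

end Unawareness

namespace Unawareness

/-! ### Kripke models with awareness of primitive propositions -/

/-- Partitional Kripke models in which agents know which primitive propositions they are
aware of. -/
structure AwModel (n : ℕ) (Φ : Type u) : Type (u + 1) where
  State : Type u
  val : State → Φ → Prop
  rel : Fin n → State → State → Prop
  rel_equiv : ∀ i, Equivalence (rel i)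
  aware : Fin n → State → Set Φ
  aware_eq : ∀ i s t, rel i s t → aware i s = aware i t

namespace AwModel

variable {O : Type} {Φ : Type u} {n : ℕ} (box : Fin n ≃ O) (M : AwModel n Φ)

/-- Truth at a state, with the modal operators read as explicit knowledge. -/
def Sat : Fm O Φ → M.State → Prop
  | .top, _ => True
  | .atom p, s => M.val s p
  | .neg φ, s => ¬ Sat φ s
  | .and φ ψ, s => Sat φ s ∧ Sat ψ s
  | .op o φ, s => φ.prims ⊆ M.aware (box.symm o) s ∧ ∀ t, M.rel (box.symm o) s t → Sat φ t

/-- Truth at all states of all models. -/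
def Valid (φ : Fm O Φ) : Prop := ∀ (M : AwModel n Φ) (s : M.State), M.Sat box φ s

variable {M}

theorem isPropEval_sat (s : M.State) : IsPropEval (fun φ => M.Sat box φ s) :=
  ⟨trivial, fun _ => Iff.rfl, fun _ _ => Iff.rfl⟩

@[simp] theorem sat_top (s : M.State) : M.Sat box .top s := trivial

@[simp] theorem sat_neg (φ : Fm O Φ) (s : M.State) : M.Sat box (.neg φ) s ↔ ¬ M.Sat box φ s :=
  Iff.rfl

@[simp] theorem sat_and (φ ψ : Fm O Φ) (s : M.State) :
    M.Sat box (.and φ ψ) s ↔ M.Sat box φ s ∧ M.Sat box ψ s := Iff.rfl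

@[simp] theorem sat_imp (φ ψ : Fm O Φ) (s : M.State) :
    M.Sat box (.imp φ ψ) s ↔ (M.Sat box φ s → M.Sat box ψ s) := (isPropEval_sat box s).imp φ ψ

@[simp] theorem sat_iff (φ ψ : Fm O Φ) (s : M.State) :
    M.Sat box (.iff φ ψ) s ↔ (M.Sat box φ s ↔ M.Sat box ψ s) := (isPropEval_sat box s).iff φ ψ

theorem sat_box (i : Fin n) (φ : Fm O Φ) (s : M.State) :
    M.Sat box (.op (box i) φ) s ↔ φ.prims ⊆ M.aware i s ∧ ∀ t, M.rel i s t → M.Sat box φ t := by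
  simp [Sat]

theorem sat_box_congr {i : Fin n} {s t : M.State} (h : M.rel i s t) (φ : Fm O Φ) :
    M.Sat box (.op (box i) φ) s ↔ M.Sat box (.op (box i) φ) t := by
  have he := M.rel_equiv i
  simp only [sat_box, M.aware_eq i s t h]
  exact and_congr_right fun _ => ⟨fun H u hu => H u (he.trans h hu),
    fun H u hu => H u (he.trans (he.symm h) hu)⟩

@[simp] theorem sat_aw (i : Fin n) (φ : Fm O Φ) (s : M.State) :
    M.Sat box (Aw box i φ) s ↔ φ.prims ⊆ M.aware i s := by
  rw [(isPropEval_sat box s).aw]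
  constructor
  · rintro (h | h) <;> exact ((sat_box box i _ s).1 h).1
  · intro h
    by_cases hk : M.Sat box (.op (box i) φ) s
    · exact .inl hk
    -- An aware agent who does not know `φ` fails to know it throughout the class, hence knows this.
    · exact .inr ((sat_box box i _ s).2 ⟨h, fun t ht => by rwa [sat_neg, ← sat_box_congr box ht]⟩)

theorem sat_of_box {i : Fin n} {φ : Fm O Φ} {s : M.State} (h : M.Sat box (.op (box i) φ) s) :
    M.Sat box φ s :=
  ((sat_box box i φ s).1 h).2 s ((M.rel_equiv i).refl s)

theorem sat_box_box {i : Fin n} {φ : Fm O Φ} {s : M.State} (h : M.Sat box (.op (box i) φ) s) :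
    M.Sat box (.op (box i) (.op (box i) φ)) s :=
  (sat_box box i _ s).2 ⟨((sat_box box i φ s).1 h).1, fun _ ht => (sat_box_congr box ht φ).1 h⟩

theorem sat_box_and (i : Fin n) (φ ψ : Fm O Φ) (s : M.State) :
    M.Sat box (.op (box i) (.and φ ψ)) s ↔
      M.Sat box (.op (box i) φ) s ∧ M.Sat box (.op (box i) ψ) s := by
  simp only [sat_box, sat_and, Fm.prims_and, Set.union_subset_iff]
  grind

/-! ### Soundness of both systems, including irrelevance. -/

/-- The model in which the agents are unaware of the primitive propositions in `Ψ`. -/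
def forget (M : AwModel n Φ) (Ψ : Set Φ) : AwModel n Φ where
  State := M.State
  val := M.val
  rel := M.rel
  rel_equiv := M.rel_equiv
  aware i s := M.aware i s \ Ψ
  aware_eq i s t h := by rw [M.aware_eq i s t h]

theorem sat_forget {Ψ : Set Φ} (ψ : Fm O Φ) (h : Disjoint Ψ ψ.prims) (s : M.State) :
    (M.forget Ψ).Sat box ψ s ↔ M.Sat box ψ s := by
  induction ψ generalizing s with
  | top => rfl
  | atom p => rfl
  | neg φ ih => exact not_congr (ih h s)
  | and φ ψ ih₁ ih₂ =>
    simp only [Fm.prims_and, Set.disjoint_union_right] at h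
    exact and_congr (ih₁ h.1 s) (ih₂ h.2 s)
  | op o φ ih =>
    refine and_congr ?_ (forall_congr' fun t => imp_congr_right fun _ => ih h t)
    exact Set.subset_sdiff.trans (and_iff_left h.symm)

theorem valid_of_s5 {irr : Prop} {φ : Fm O Φ} (h : S5Provable box irr φ) : Valid box φ := by
  induction h with
  | prop φ h => exact fun M s => h.eval (isPropEval_sat box s)
  | axXA i φ =>
    intro M s
    rw [sat_imp, sat_aw]
    exact fun h => ((sat_box box i φ s).1 h).1
  | axK i φ ψ =>
    intro M s
    simp only [sat_imp, sat_and, sat_aw, sat_box]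
    rintro ⟨⟨⟨_, h₁⟩, _, h₂⟩, h₃⟩
    exact ⟨h₃, fun t ht => h₂ t ht (h₁ t ht)⟩
  | axT i φ => exact fun M s => (sat_imp box _ _ s).2 (sat_of_box box)
  | ax4 i φ => exact fun M s => (sat_imp box _ _ s).2 (sat_box_box box)
  | ax5 i φ =>
    intro M s
    rw [sat_imp, sat_and, sat_aw, sat_neg]
    exact fun h => (sat_box box i _ s).2
      ⟨h.2, fun t ht => by rw [sat_neg, ← sat_box_congr box ht]; exact h.1⟩
  | axATop i => simp [Valid]
  | axANeg i φ => simp [Valid]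
  | axAAnd i φ ψ => simp [Valid]
  | axAK i j φ => simp [Valid]
  | axAA i j φ => simp [Valid]
  | axKA i φ =>
    intro M s
    simp only [sat_imp, sat_aw, sat_box, Fm.prims_aw]
    exact fun h => ⟨h, fun t ht => M.aware_eq i s t ht ▸ h⟩
  | mp φ ψ _ _ h₁ h₂ => exact fun M s => (sat_imp box _ _ s).1 (h₂ M s) (h₁ M s)
  | gen i φ _ h =>
    intro M s
    rw [sat_imp, sat_aw, sat_box]
    exact fun h' => ⟨h', fun t _ => h M t⟩
  | irrel i φ ψ _ hne hd _ h =>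
    intro M s
    -- Forgetting the primitives of `φ`, of which there is at least one, makes the agent unaware of
    -- `φ` without affecting `ψ`.
    have h' := (sat_imp (M := M.forget φ.prims) box _ _ s).1 (h (M.forget φ.prims) s)
    refine (sat_forget box ψ hd s).1 (h' fun hsub => ?_)
    obtain ⟨p, hp⟩ := hne
    exact ((sat_aw (M := M.forget φ.prims) box i φ s).1 hsub hp).2 hp

theorem valid_of_u {φ : Fm O Φ} (h : UProvable box φ) : Valid box φ := by
  induction h with
  | prop φ h => exact fun M s => h.eval (isPropEval_sat box s)
  | axT i φ => exact fun M s => (sat_imp box _ _ s).2 (sat_of_box box)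
  | ax4 i φ => exact fun M s => (sat_imp box _ _ s).2 (sat_box_box box)
  | axM i φ ψ => exact fun M s => (sat_imp box _ _ s).2 (sat_box_and box i φ ψ s).1
  | axC i φ ψ => exact fun M s => (sat_imp box _ _ s).2 (sat_box_and box i φ ψ s).2
  | axA i φ => simp [Valid]
  | axAM i φ ψ => simp [Valid]
  | axN i => simp [Valid, sat_box]
  | axAK i j φ => simp [Valid]
  | mp φ ψ _ _ h₁ h₂ => exact fun M s => (sat_imp box _ _ s).1 (h₂ M s) (h₁ M s)
  | re i φ ψ hp _ h =>
    intro M s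
    rw [sat_iff, sat_box, sat_box, hp]
    exact and_congr_right fun _ => forall_congr' fun t =>
      imp_congr_right fun _ => (sat_iff box _ _ t).1 (h M t)

/-! ### The canonical model -/

/-- A maximal consistent set of formulas. -/
structure IsMaxConsistent (e : Fm O Φ → Prop) : Prop where
  eval : IsPropEval e
  thm : ∀ φ, S5Provable box False φ → e φ

section

variable {box} {e : Fm O Φ → Prop} (he : IsMaxConsistent box e)
include he

theorem IsMaxConsistent.imp {φ ψ : Fm O Φ} (h : S5Provable box False (.imp φ ψ)) (hφ : e φ) :
    e ψ :=
  (he.eval.imp _ _).1 (he.thm _ h) hφ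

theorem IsMaxConsistent.iff {φ ψ : Fm O Φ} (h : S5Provable box False (.iff φ ψ)) : e φ ↔ e ψ :=
  (he.eval.iff _ _).1 (he.thm _ h)

/-- The awareness axioms push `A_i` through every connective, so sets of primitives suffice to
record awareness. -/
theorem IsMaxConsistent.aw_iff (i : Fin n) (φ : Fm O Φ) :
    e (Aw box i φ) ↔ ∀ p ∈ φ.prims, e (Aw box i (.atom p)) := by
  induction φ with
  | top => simpa using he.thm _ (.axATop i)
  | atom p => simp
  | neg φ ih => exact (he.iff (.axANeg i φ)).trans ih
  | and φ ψ ih₁ ih₂ =>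
    rw [he.iff (.axAAnd i φ ψ), he.eval.and, ih₁, ih₂]
    simp only [Fm.prims_and, Set.mem_union]
    grind
  | op o φ ih =>
    obtain ⟨j, rfl⟩ := box.surjective o
    exact (he.iff (.axAK i j φ)).trans ih

/-- If `□_i φ` fails at a maximal consistent set that is aware of `φ`, then `φ` fails at a maximal
consistent set that contains all formulas known at the given one. -/
theorem IsMaxConsistent.exists_not {i : Fin n} {φ : Fm O Φ} (ha : e (Aw box i φ))
    (hk : ¬ e (.op (box i) φ)) :
    ∃ d : Fm O Φ → Prop, IsMaxConsistent box d ∧ (∀ ψ, e (.op (box i) ψ) → d ψ) ∧ ¬ d φ := by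
  have hT := S5Provable.isTheory (Φ := Φ) box False
  have hAK (ψ : Fm O Φ) (h : e (.op (box i) ψ)) : e (Aw box i ψ) := he.imp (.axXA i ψ) h
  have hgen (ψ : Fm O Φ) (h : S5Provable box False ψ) (h' : e (Aw box i ψ)) :
      e (.op (box i) ψ) := he.imp (.gen i ψ h) h'
  have hand (ψ χ : Fm O Φ) (h : e (Aw box i ψ)) (h' : e (Aw box i χ)) :
      e (Aw box i (.and ψ χ)) := (he.iff (.axAAnd i ψ χ)).2 ((he.eval.and _ _).2 ⟨h, h'⟩)
  have hneg (ψ : Fm O Φ) (h : e (Aw box i ψ)) : e (Aw box i (.neg ψ)) :=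
    (he.iff (.axANeg i ψ)).2 h
  have himp (ψ χ : Fm O Φ) (h : e (Aw box i ψ)) (h' : e (Aw box i χ)) :
      e (Aw box i (.imp ψ χ)) := hneg _ (hand _ _ (hneg _ (hneg _ h)) (hneg _ h'))
  have hK (ψ χ : Fm O Φ) (h : e (.op (box i) ψ)) (h' : e (.op (box i) (.imp ψ χ)))
      (h'' : e (Aw box i χ)) : e (.op (box i) χ) :=
    he.imp (.axK i ψ χ) (by simp only [he.eval.and]; exact ⟨⟨h, h'⟩, h''⟩)
  have hKc (ψ χ : Fm O Φ) (h : e (.op (box i) ψ)) (h' : S5Provable box False (.imp ψ χ))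
      (h'' : e (Aw box i χ)) : e (.op (box i) χ) :=
    hK ψ χ h (hgen _ h' (himp _ _ (hAK _ h) h'')) h''
  have hKand (ψ χ : Fm O Φ) (h : e (.op (box i) ψ)) (h' : e (.op (box i) χ)) :
      e (.op (box i) (.and ψ χ)) :=
    hK χ _ h' (hKc ψ _ h
      (hT.taut _ fun e he => by simp only [he.and, he.imp]; tauto)
      (himp _ _ (hAK _ h') (hand _ _ (hAK _ h) (hAK _ h')))) (hand _ _ (hAK _ h) (hAK _ h'))
  -- Consequences of known formulas need not be known, for lack of awareness; hence the existential
  -- over a known `θ`. Conjoining the known premises gives closure under modus ponens.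
  have htheory : IsTheory
      (fun χ : Fm O Φ => ∃ θ, e (.op (box i) θ) ∧ S5Provable box False (.imp θ χ)) := by
    refine ⟨fun χ h => ⟨.top, hgen _ (hT.taut _ fun e he => he.top) (he.thm _ (.axATop i)),
      hT.taut _ fun e he => (he.imp _ _).2 fun _ => h e he⟩, ?_⟩
    rintro χ ξ ⟨θ₁, h₁, h₁'⟩ ⟨θ₂, h₂, h₂'⟩
    exact ⟨.and θ₁ θ₂, hKand _ _ h₁ h₂,
      hT.cons₂ (fun e he => by simp only [he.and, he.imp]; tauto) h₁' h₂'⟩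
  obtain ⟨d, hd, hsub, hdφ⟩ := htheory.exists_eval (φ := φ) (by
    rintro ⟨θ, hθ, h⟩
    exact hk (hKc θ φ hθ h ha))
  refine ⟨d, ⟨hd, fun ψ hψ => hsub _ ⟨.top, ?_, ?_⟩⟩, fun ψ hψ => hsub _ ⟨ψ, hψ, ?_⟩, hdφ⟩
  · exact hgen _ (hT.taut _ fun e he => he.top) (he.thm _ (.axATop i))
  · exact hT.cons₁ (fun e he h => (he.imp _ _).2 fun _ => h) hψ
  · exact hT.taut _ fun e he => (he.imp _ _).2 id

end

/-- The states of the canonical model are the maximal consistent sets, restricted to the formulas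
over some set of primitive propositions. -/
def canonical : AwModel n Φ where
  State := {e : Set (Fm O Φ) // IsMaxConsistent box e} × Set Φ
  val s p := s.1.1 (.atom p)
  rel i s t := ∀ φ : Fm O Φ,
    (φ.prims ⊆ s.2 ∧ s.1.1 (.op (box i) φ)) ↔ (φ.prims ⊆ t.2 ∧ t.1.1 (.op (box i) φ))
  rel_equiv i := ⟨fun _ _ => Iff.rfl, fun h φ => (h φ).symm, fun h h' φ => (h φ).trans (h' φ)⟩
  aware i s := {p | p ∈ s.2 ∧ s.1.1 (Aw box i (.atom p))}
  aware_eq i s t h := by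
    ext p
    -- Awareness of `p` is a disjunction of two knowledge claims over `{p}`, and related states
    -- share both.
    have h₁ := h (.atom p)
    have h₂ := h (.neg (.op (box i) (.atom p)))
    simp only [Fm.prims_atom, Fm.prims_neg, Fm.prims_op, Set.singleton_subset_iff] at h₁ h₂
    simp only [Set.mem_ofPred_eq, s.1.2.eval.aw, t.1.2.eval.aw]
    tauto

theorem canonical_subset_aware (i : Fin n) (φ : Fm O Φ) (s : (canonical (Φ := Φ) box).State) :
    φ.prims ⊆ (canonical box).aware i s ↔ φ.prims ⊆ s.2 ∧ s.1.1 (Aw box i φ) := by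
  rw [s.1.2.aw_iff]
  exact Set.subset_inter_iff

/-- The truth lemma, which can only be expected within the vocabulary of the state. -/
theorem sat_canonical (φ : Fm O Φ) (s : (canonical (Φ := Φ) box).State) (hs : φ.prims ⊆ s.2) :
    (canonical box).Sat box φ s ↔ s.1.1 φ := by
  induction φ generalizing s with
  | top => exact iff_of_true trivial s.1.2.eval.top
  | atom p => rfl
  | neg φ ih => rw [sat_neg, ih s hs, s.1.2.eval.neg]
  | and φ ψ ih₁ ih₂ =>
    simp only [Fm.prims_and, Set.union_subset_iff] at hs
    rw [sat_and, ih₁ s hs.1, ih₂ s hs.2, s.1.2.eval.and]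
  | op o φ ih =>
    obtain ⟨i, rfl⟩ := box.surjective o
    rw [sat_box, canonical_subset_aware]
    constructor
    · rintro ⟨⟨_, ha⟩, h⟩
      by_contra hk
      obtain ⟨d, hd, hsub, hdφ⟩ := s.1.2.exists_not ha hk
      -- In `d` the agent may be aware of more than at `s`; cutting the vocabulary down to the
      -- awareness at `s` makes the two states indistinguishable.
      let t : (canonical (Φ := Φ) box).State := (⟨d, hd⟩, (canonical box).aware i s)
      have hst : (canonical box).rel i s t := by
        intro ψ
        change _ ↔ ψ.prims ⊆ (canonical box).aware i s ∧ d (.op (box i) ψ)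
        rw [canonical_subset_aware]
        constructor
        · rintro ⟨h₁, h₂⟩
          exact ⟨⟨h₁, s.1.2.imp (.axXA i ψ) h₂⟩, hsub _ (s.1.2.imp (.ax4 i ψ) h₂)⟩
        · rintro ⟨⟨h₁, h₂⟩, h₃⟩
          -- Otherwise awareness of `ψ` at `s` means that `¬□ψ` is known there, so it would lie in
          -- `d`.
          refine ⟨h₁, (((s.1.2.eval.aw box i ψ).1 h₂).resolve_right fun h₄ => ?_)⟩
          exact (hd.eval.neg _).1 (hsub _ h₄) h₃
      exact hdφ ((ih t ((canonical_subset_aware box i φ s).2 ⟨hs, ha⟩)).1 (h t hst))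
    · intro h
      refine ⟨⟨hs, s.1.2.imp (.axXA i φ) h⟩, fun t ht => ?_⟩
      obtain ⟨h₁, h₂⟩ := (ht φ).1 ⟨hs, h⟩
      exact (ih t h₁).2 (t.1.2.imp (.axT i φ) h₂)

theorem s5_of_valid {φ : Fm O Φ} (h : Valid box φ) : S5Provable box False φ := by
  by_contra hφ
  obtain ⟨e, he, hthm, heφ⟩ := (S5Provable.isTheory box False).exists_eval hφ
  exact heφ ((sat_canonical box φ (⟨e, he, hthm⟩, Set.univ) (Set.subset_univ _)).1 (h _ _))

theorem u_soundAndComplete :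
    SoundAndComplete (UProvable (Φ := Φ) box) (Valid box) :=
  ⟨fun _ => valid_of_u box, fun _ h => (s5_of_valid box h).toU⟩

theorem s5_soundAndComplete (irr : Prop) :
    SoundAndComplete (S5Provable (Φ := Φ) box irr) (Valid box) :=
  ⟨fun _ => valid_of_s5 box, fun _ h => (s5_of_valid box h).mono False.elim⟩

end AwModel

end Unawareness

namespace Unawareness

variable {Φ : Type u} {n : ℕ}

/-! ### Awareness structures -/

/-- The operators `X_1, …, X_n` are indexed by the agents. -/
def XOp.equiv (n : ℕ) : Fin n ≃ XOp n where
  toFun := .X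
  invFun | .X i => i
  left_inv _ := rfl
  right_inv | .X _ => rfl

namespace AwarenessStructure

/-- The model of awareness of primitive propositions underlying an awareness structure. -/
def toAwModel (M : AwarenessStructure n Φ) (hM : M.IsPartitional) (hk : M.AgentsKnowAwareness) :
    AwModel n Φ where
  State := M.State
  val s p := M.val s p = true
  rel i s t := t ∈ M.poss i s
  rel_equiv i := ⟨hM.reflexive i, fun {s t} h => hM.euclidean i s t h (hM.reflexive i s),
    fun {s t _} h h' => hM.transitive i s t h h'⟩
  aware i s := {p | .atom p ∈ M.aware i s}
  aware_eq i s t h := by rw [hk i s t h]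

theorem sat_toAwModel (M : AwarenessStructure n Φ) (hM : M.IsPartitional)
    (hd : M.PropositionallyDetermined) (φ : LX n Φ) (s : M.State) :
    (M.toAwModel hM hd.2).Sat (XOp.equiv n) φ s ↔ M.Sat φ.toLKXA s := by
  induction φ generalizing s with
  | top => rfl
  | atom p => rfl
  | neg φ ih => exact not_congr (ih s)
  | and φ ψ ih₁ ih₂ => exact and_congr (ih₁ s) (ih₂ s)
  | op o φ ih =>
    obtain ⟨i⟩ := o
    refine and_congr ?_ (forall_congr' fun t => imp_congr_right fun _ => ih t)
    exact (Fm.prims_mapOp XOp.toKXA φ ▸ hd.1 i s (φ.mapOp XOp.toKXA)).symm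

end AwarenessStructure

namespace AwModel

open Classical in
/-- A model of awareness of primitive propositions as an awareness structure. -/
noncomputable def toAwarenessStructure (M : AwModel n Φ) : AwarenessStructure n Φ where
  State := M.State
  val s p := decide (M.val s p)
  poss i s := {t | M.rel i s t}
  aware i s := {φ | φ.prims ⊆ M.aware i s}

theorem toAwarenessStructure_isPartitional (M : AwModel n Φ) :
    M.toAwarenessStructure.IsPartitional where
  reflexive i := (M.rel_equiv i).refl
  transitive i _ _ ht _ hu := (M.rel_equiv i).trans ht hu
  euclidean i _ _ ht _ hu := (M.rel_equiv i).trans ((M.rel_equiv i).symm ht) hu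

theorem toAwarenessStructure_propositionallyDetermined (M : AwModel n Φ) :
    M.toAwarenessStructure.PropositionallyDetermined := by
  constructor
  · intro i s φ
    change φ.prims ⊆ M.aware i s ↔ ∀ p ∈ φ.prims, {p} ⊆ M.aware i s
    simp only [Set.singleton_subset_iff]
    rfl
  · intro i s t ht
    change {φ : LKXA n Φ | φ.prims ⊆ M.aware i s} = {φ | φ.prims ⊆ M.aware i t}
    rw [M.aware_eq i s t ht]

open Classical in
theorem sat_toAwarenessStructure (M : AwModel n Φ) (φ : LX n Φ) (s : M.State) :
    M.toAwarenessStructure.Sat φ.toLKXA s ↔ M.Sat (XOp.equiv n) φ s := by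
  induction φ generalizing s with
  | top => rfl
  | atom p => exact decide_eq_true_iff
  | neg φ ih => exact not_congr (ih s)
  | and φ ψ ih₁ ih₂ => exact and_congr (ih₁ s) (ih₂ s)
  | op o φ ih =>
    obtain ⟨i⟩ := o
    refine and_congr ?_ (forall_congr' fun t => imp_congr_right fun _ => ih t)
    change (Fm.mapOp XOp.toKXA φ).prims ⊆ M.aware i s ↔ _
    rw [Fm.prims_mapOp]
    rfl

end AwModel

theorem awarenessValid_iff (φ : LX n Φ) : AwarenessValid φ ↔ AwModel.Valid (XOp.equiv n) φ :=
  ⟨fun h M s => (M.sat_toAwarenessStructure φ s).1 (h _ M.toAwarenessStructure_isPartitional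
    M.toAwarenessStructure_propositionallyDetermined s),
   fun h M hM hd s => (M.sat_toAwModel hM hd φ s).1 (h (M.toAwModel hM hd.2) s)⟩

/-! ### HMS structures -/

/-- The operators `K_1, …, K_n` are indexed by the agents. -/
def KOp.equiv (n : ℕ) : Fin n ≃ KOp n where
  toFun := .K
  invFun | .K i => i
  left_inv _ := rfl
  right_inv | .K _ => rfl

namespace HMSStructure

variable (M : HMSStructure n Φ)

/-- An idempotent surjection is the identity. -/
theorem proj_self (s : M.State) : M.proj (M.vocab s) (M.vocab s) s = s := by
  obtain ⟨t, ht, hts⟩ := M.proj_surj _ _ subset_rfl s rfl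
  have h := M.proj_proj _ _ _ subset_rfl subset_rfl t ht
  rwa [hts] at h

variable {M}

theorem poss_nonempty (hM : M.IsPartitional) (i : Fin n) (s : M.State) :
    (M.poss i s).Nonempty := by
  obtain ⟨_, _, _, _, _, h⟩ := hM.generalizedReflexivity i s
  exact ⟨_, h⟩

theorem vocab_eq_of_mem_poss (hM : M.IsPartitional) {i : Fin n} {s t u : M.State}
    (ht : t ∈ M.poss i s) (hu : u ∈ M.poss i s) : M.vocab t = M.vocab u := by
  obtain ⟨Ψ, _, h⟩ := hM.confinedness i _ s rfl
  exact (h ht).trans (h hu).symm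

theorem vocab_subset_of_mem_poss (hM : M.IsPartitional) {i : Fin n} {s t : M.State}
    (ht : t ∈ M.poss i s) : M.vocab t ⊆ M.vocab s := by
  obtain ⟨Ψ, hΨ, h⟩ := hM.confinedness i _ s rfl
  exact (h ht).symm ▸ hΨ

theorem poss_eq_of_mem (hM : M.IsPartitional) {i : Fin n} {s t : M.State}
    (ht : t ∈ M.poss i s) : M.poss i t = M.poss i s :=
  (hM.stationarityA i s t ht).antisymm (hM.stationarityB i s t ht)

theorem subset_up (hM : M.IsPartitional) (i : Fin n) (s : M.State) :
    M.poss i s ⊆ M.up (M.poss i s) := fun t ht =>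
  ⟨_, _, fun _ hu => vocab_eq_of_mem_poss hM hu ht, subset_rfl, rfl, (M.proj_self t).symm ▸ ht⟩

/-- Only formulas over the vocabulary of a state are true there. -/
theorem prims_subset_of_sat (hM : M.IsPartitional) {φ : LK n Φ} {s : M.State} (h : M.Sat φ s) :
    φ.prims ⊆ M.vocab s := by
  induction φ generalizing s with
  | top => exact Set.empty_subset _
  | atom p =>
    refine Set.singleton_subset_iff.2 ((M.val_ne_half_iff s p).1 ?_)
    have h : M.val s p = TV.one := h
    simp [h]
  | neg φ => exact h.2
  | and φ ψ ih₁ ih₂ => exact Set.union_subset (ih₁ h.1) (ih₂ h.2)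
  | op o φ ih =>
    obtain ⟨i⟩ := o
    obtain ⟨t, ht⟩ := poss_nonempty hM i s
    exact (ih (h t ht)).trans (vocab_subset_of_mem_poss hM ht)

/-- What an agent considers possible at the projection of a state is the projection of what the
agent considers possible at that state. -/
theorem poss_proj (hM : M.IsPartitional) (i : Fin n) {Ψ Ψ₂ : Set Φ} {s : M.State}
    (hΨ : Ψ ⊆ M.vocab s) (h₂ : M.poss i s ⊆ M.S Ψ₂) :
    M.poss i (M.proj (M.vocab s) Ψ s) = M.proj Ψ₂ (Ψ ∩ Ψ₂) '' M.poss i s := by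
  obtain ⟨t, ht⟩ := poss_nonempty hM i s
  have hΨ₂ : Ψ₂ ⊆ M.vocab s := by
    have h := vocab_subset_of_mem_poss hM ht
    rwa [h₂ ht] at h
  set s' := M.proj (M.vocab s) Ψ s with hs'
  have hv' : M.vocab s' = Ψ := M.vocab_proj _ _ hΨ s rfl
  obtain ⟨Ψ', hΨ', h'⟩ := hM.confinedness i Ψ s' hv'
  have hup := hM.projectionsPreserveIgnorance i _ Ψ hΨ s rfl
  -- By preservation of ignorance, states possible at `s` lie above the space of those possible at
  -- `s'`.
  have sub₂ : Ψ' ⊆ Ψ₂ := by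
    obtain ⟨Θ, Θ', hΘ, hΘ', htΘ, htp⟩ := hup (subset_up hM i s ht)
    have : Θ = Ψ' := (hΘ htp).symm.trans (h' htp)
    have h3 : Ψ₂ = Θ' := (h₂ ht).symm.trans htΘ
    exact this ▸ h3 ▸ hΘ'
  have hppk := hM.projectionsPreserveKnowledge i (Ψ ∩ Ψ₂) Ψ₂ _ Set.inter_subset_right hΨ₂ s rfl h₂
  have hvq : ∀ u ∈ M.poss i (M.proj (M.vocab s) (Ψ ∩ Ψ₂) s), M.vocab u = Ψ ∩ Ψ₂ := by
    rw [← hppk]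
    rintro _ ⟨u, hu, rfl⟩
    exact M.vocab_proj _ _ Set.inter_subset_right u (h₂ hu)
  have hcomp : M.proj Ψ (Ψ ∩ Ψ₂) s' = M.proj (M.vocab s) (Ψ ∩ Ψ₂) s :=
    M.proj_proj _ _ _ Set.inter_subset_left hΨ s rfl
  -- For the other inclusion, project `s'` on to `Ψ ∩ Ψ₂`: preservation of knowledge locates the
  -- possible states there, and preservation of ignorance puts those of `s'` above them.
  have heq : Ψ' = Ψ ∩ Ψ₂ := by
    refine (Set.subset_inter hΨ' sub₂).antisymm ?_
    have hup' := hM.projectionsPreserveIgnorance i Ψ (Ψ ∩ Ψ₂) Set.inter_subset_left s' hv'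
    rw [hcomp] at hup'
    obtain ⟨u, hu⟩ := poss_nonempty hM i s'
    obtain ⟨Θ, Θ', hΘ, hΘ', huΘ, hup⟩ := hup' (subset_up hM i s' hu)
    have h3 : Θ = Ψ ∩ Ψ₂ := (hΘ hup).symm.trans (hvq _ hup)
    have h4 : Ψ' = Θ' := (h' hu).symm.trans huΘ
    exact h3 ▸ h4 ▸ hΘ'
  have hid := hM.projectionsPreserveKnowledge i Ψ' Ψ' Ψ subset_rfl hΨ' s' hv' h'
  rw [heq, hcomp, ← hppk] at hid
  rw [← hid]
  refine Eq.symm ((Set.image_congr fun u hu => ?_).trans (Set.image_id _))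
  have hu' := (h' hu).trans heq
  have := M.proj_self u
  rwa [hu'] at this

/-- Projections preserve the truth of formulas over the smaller vocabulary. -/
theorem sat_proj (hM : M.IsPartitional) {φ : LK n Φ} {Ψ : Set Φ} (hφ : φ.prims ⊆ Ψ)
    {s : M.State} (hΨ : Ψ ⊆ M.vocab s) :
    M.Sat φ (M.proj (M.vocab s) Ψ s) ↔ M.Sat φ s := by
  induction φ generalizing Ψ s with
  | top => rfl
  | atom p =>
    change M.val _ p = _ ↔ M.val _ p = _
    rw [M.val_proj _ _ hΨ s rfl p (hφ rfl)]
  | neg φ ih =>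
    refine and_congr (not_congr (ih hφ hΨ)) (iff_of_true ?_ (hφ.trans hΨ))
    rwa [M.vocab_proj _ _ hΨ s rfl]
  | and φ ψ ih₁ ih₂ =>
    have h := Set.union_subset_iff.1 hφ
    exact and_congr (ih₁ h.1 hΨ) (ih₂ h.2 hΨ)
  | op o φ ih =>
    obtain ⟨i⟩ := o
    obtain ⟨Ψ₂, h₂s, h₂⟩ := hM.confinedness i _ s rfl
    change (∀ t ∈ M.poss i (M.proj (M.vocab s) Ψ s), M.Sat φ t) ↔ ∀ t ∈ M.poss i s, M.Sat φ t
    rw [poss_proj hM i hΨ h₂, Set.forall_mem_image]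
    -- The vocabulary condition is met whenever either side of the equivalence holds: possibility
    -- sets are nonempty and true formulas are defined.
    have key : φ.prims ⊆ Ψ₂ → ∀ t ∈ M.poss i s,
        (M.Sat φ (M.proj Ψ₂ (Ψ ∩ Ψ₂) t) ↔ M.Sat φ t) := by
      intro h t ht
      have hv : M.vocab t = Ψ₂ := h₂ ht
      subst hv
      exact ih (Set.subset_inter hφ h) Set.inter_subset_right
    obtain ⟨t, ht⟩ := poss_nonempty hM i s
    constructor
    · intro H u hu
      refine (key ?_ u hu).1 (H hu)
      have h := prims_subset_of_sat hM (H ht)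
      rw [M.vocab_proj Ψ₂ _ Set.inter_subset_right t (h₂ ht)] at h
      exact h.trans Set.inter_subset_right
    · intro H u hu
      refine (key ?_ u hu).2 (H u hu)
      have h := prims_subset_of_sat hM (H t ht)
      rwa [h₂ ht] at h

/-- The Kripke model with the states of a partitional HMS structure in which two states are
indistinguishable for an agent if the agent considers the same states possible there. -/
def toAwModel (M : HMSStructure n Φ) : AwModel n Φ where
  State := M.State
  val s p := M.val s p = TV.one
  -- Possibility itself is not reflexive when the possible states lie in a smaller space.
  rel i s t := M.poss i s = M.poss i t
  rel_equiv _ := ⟨fun _ => rfl, Eq.symm, Eq.trans⟩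
  aware i s := {p | ∃ t ∈ M.poss i s, p ∈ M.vocab t}
  aware_eq i s t h := by rw [h]

theorem toAwModel_aware (hM : M.IsPartitional) {i : Fin n} {s t : M.State}
    (ht : t ∈ M.poss i s) : M.toAwModel.aware i s = M.vocab t := by
  ext p
  exact ⟨fun ⟨u, hu, hp⟩ => vocab_eq_of_mem_poss hM hu ht ▸ hp, fun hp => ⟨t, ht, hp⟩⟩

theorem sat_toAwModel (hM : M.IsPartitional) (φ : LK n Φ) (s : M.State)
    (hφ : φ.prims ⊆ M.vocab s) : M.toAwModel.Sat (KOp.equiv n) φ s ↔ M.Sat φ s := by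
  induction φ generalizing s with
  | top => rfl
  | atom p => rfl
  | neg φ ih => exact (not_congr (ih s hφ)).trans (and_iff_left hφ).symm
  | and φ ψ ih₁ ih₂ =>
    have h := Set.union_subset_iff.1 hφ
    exact and_congr (ih₁ s h.1) (ih₂ s h.2)
  | op o φ ih =>
    obtain ⟨i⟩ := o
    change (φ.prims ⊆ M.toAwModel.aware i s ∧
      ∀ t : M.State, M.poss i s = M.poss i t → M.toAwModel.Sat (KOp.equiv n) φ t) ↔
      ∀ t ∈ M.poss i s, M.Sat φ t
    constructor
    · rintro ⟨ha, h⟩ t ht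
      rw [toAwModel_aware hM ht] at ha
      exact (ih t ha).1 (h t (poss_eq_of_mem hM ht).symm)
    · intro h
      obtain ⟨t₀, ht₀⟩ := poss_nonempty hM i s
      have hsub := prims_subset_of_sat hM (h t₀ ht₀)
      refine ⟨(toAwModel_aware hM ht₀).symm ▸ hsub, fun t ht => ?_⟩
      -- Some projection of `t` is possible at `t`, hence at `s`, so `φ` holds there and lifts back
      -- to `t` by `sat_proj`.
      obtain ⟨Ψ, Ψ', hB, hΨ, htΨ', htp⟩ := hM.generalizedReflexivity i t
      have hv : M.vocab t = Ψ' := htΨ'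
      subst hv
      have hs := h _ (ht ▸ htp)
      have hp := prims_subset_of_sat hM hs
      rw [M.vocab_proj _ _ hΨ t rfl] at hp
      exact (ih t (hp.trans hΨ)).2 ((sat_proj hM hp hΨ).1 hs)

end HMSStructure

/-! ### HMS structures built from Kripke models. -/

namespace AwModel

open Classical in
/-- The HMS structure whose states are the restrictions of the states of a Kripke model to sets of
primitive propositions. -/
noncomputable def toHMS (M : AwModel n Φ) : HMSStructure n Φ where
  State := M.State × Set Φ
  vocab s := s.2
  poss i s := {t | M.rel i s.1 t.1 ∧ t.2 = s.2 ∩ M.aware i s.1}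
  val s p := if p ∈ s.2 then if M.val s.1 p then .one else .zero else .half
  proj _ Ψ s := (s.1, Ψ)
  val_ne_half_iff s p := by split_ifs <;> simp_all
  vocab_proj _ _ _ _ _ := rfl
  proj_surj Ψ' Ψ _ t ht := ⟨(t.1, Ψ'), rfl, by rw [← ht]⟩
  proj_proj _ _ _ _ _ _ _ := rfl
  val_proj Ψ' Ψ h s hs p hp := by
    subst hs
    simp [hp, h hp]

variable (M : AwModel n Φ)

theorem mem_up_poss_toHMS (i : Fin n) (s t : M.toHMS.State) :
    t ∈ M.toHMS.up (M.toHMS.poss i s) ↔ M.rel i s.1 t.1 ∧ s.2 ∩ M.aware i s.1 ⊆ t.2 := by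
  constructor
  · rintro ⟨Ψ, _, _, h, rfl, h₁, h₂⟩
    exact ⟨h₁, h₂ ▸ h⟩
  · rintro ⟨h₁, h₂⟩
    exact ⟨_, _, fun u hu => hu.2, h₂, rfl, h₁, rfl⟩

theorem toHMS_isPartitional : M.toHMS.IsPartitional where
  confinedness i Ψ s hs := by
    have hs : s.2 = Ψ := hs
    subst hs
    exact ⟨_, Set.inter_subset_left, fun t ht => ht.2⟩
  projectionsPreserveKnowledge i Ψ₁ Ψ₂ Ψ₃ h₁ h₂ s hs hsub := by
    -- The possibility set is nonempty, so its space is determined; the agent is therefore aware of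
    -- all of `Ψ₁`.
    have hΨ₂ : s.2 ∩ M.aware i s.1 = Ψ₂ :=
      hsub (show (s.1, s.2 ∩ M.aware i s.1) ∈ M.toHMS.poss i s from
        ⟨(M.rel_equiv i).refl _, rfl⟩)
    have hΨ₁ : Ψ₁ ∩ M.aware i s.1 = Ψ₁ :=
      Set.inter_eq_left.2 (h₁.trans (hΨ₂ ▸ Set.inter_subset_right))
    ext t
    constructor
    · rintro ⟨u, hu, rfl⟩
      exact ⟨hu.1, hΨ₁.symm⟩
    · rintro ⟨h, h'⟩
      exact ⟨(t.1, s.2 ∩ M.aware i s.1), ⟨h, rfl⟩, Prod.ext rfl (hΨ₁.symm.trans h'.symm)⟩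
  projectionsPreserveIgnorance i Ψ' Ψ h s hs t ht := by
    have hs : s.2 = Ψ' := hs
    rw [mem_up_poss_toHMS] at ht ⊢
    exact ⟨ht.1, (Set.inter_subset_inter_left _ (hs ▸ h)).trans ht.2⟩
  generalizedReflexivity i s :=
    (M.mem_up_poss_toHMS i s s).2 ⟨(M.rel_equiv i).refl _, Set.inter_subset_left⟩
  stationarityA i s t ht u hu := by
    refine ⟨(M.rel_equiv i).trans ht.1 hu.1, hu.2.trans ?_⟩
    rw [ht.2, ← M.aware_eq i _ _ ht.1, Set.inter_assoc, Set.inter_self]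
  stationarityB i s t ht u hu := by
    refine ⟨(M.rel_equiv i).trans ((M.rel_equiv i).symm ht.1) hu.1, hu.2.trans ?_⟩
    rw [ht.2, ← M.aware_eq i _ _ ht.1, Set.inter_assoc, Set.inter_self]

open Classical in
theorem sat_toHMS (φ : LK n Φ) (s : M.toHMS.State) (hφ : φ.prims ⊆ s.2) :
    M.toHMS.Sat φ s ↔ M.Sat (KOp.equiv n) φ s.1 := by
  induction φ generalizing s with
  | top => rfl
  | atom p =>
    have hp : p ∈ s.2 := hφ rfl
    change (if p ∈ s.2 then if M.val s.1 p then TV.one else .zero else .half) = .one ↔ M.val s.1 p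
    simp [hp]
  | neg φ ih => exact (and_iff_left hφ).trans (not_congr (ih s hφ))
  | and φ ψ ih₁ ih₂ =>
    have h := Set.union_subset_iff.1 hφ
    exact and_congr (ih₁ s h.1) (ih₂ s h.2)
  | op o φ ih =>
    obtain ⟨i⟩ := o
    constructor
    · intro h
      -- Truth at the possible restriction of `s` itself forces `φ` to be defined there: this
      -- recovers the awareness condition.
      have hsub : φ.prims ⊆ s.2 ∩ M.aware i s.1 :=
        HMSStructure.prims_subset_of_sat M.toHMS_isPartitional
          (h (s.1, s.2 ∩ M.aware i s.1) ⟨(M.rel_equiv i).refl _, rfl⟩)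
      exact ⟨hsub.trans Set.inter_subset_right, fun t ht =>
        (ih (t, s.2 ∩ M.aware i s.1) hsub).1 (h _ ⟨ht, rfl⟩)⟩
    · rintro ⟨ha, h⟩ t ⟨ht₁, ht₂⟩
      exact (ih t (ht₂ ▸ Set.subset_inter hφ ha)).2 (h t.1 ht₁)

end AwModel

/-- A Kripke countermodel gives an HMS one at full vocabulary; conversely, a state where `φ` is
false has the vocabulary needed for truth to transfer. -/
theorem weaklyValid_iff (φ : LK n Φ) : WeaklyValid φ ↔ AwModel.Valid (KOp.equiv n) φ := by
  constructor
  · intro h M s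
    by_contra hs
    have hu : φ.prims ⊆ ((s, Set.univ) : M.toHMS.State).2 := Set.subset_univ _
    exact h M.toHMS M.toHMS_isPartitional (s, Set.univ)
      ⟨fun h' => hs ((M.sat_toHMS φ _ hu).1 h'), hu⟩
  · rintro h M hM s ⟨hs, hsub⟩
    exact hs ((HMSStructure.sat_toAwModel hM φ s hsub).1 (h M.toAwModel s))

end Unawareness

theorem mainTheorem4 (n : ℕ) (Φ : Type*) :
    Unawareness.SoundAndComplete
      (Unawareness.UProvable (Φ := Φ) (Unawareness.KOp.K (n := n)))
      Unawareness.WeaklyValid ∧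
    (∀ irr : Prop, Unawareness.SoundAndComplete
      (Unawareness.S5Provable (Φ := Φ) (Unawareness.KOp.K (n := n)) irr)
      Unawareness.WeaklyValid) ∧
    Unawareness.SoundAndComplete
      (Unawareness.UProvable (Φ := Φ) (Unawareness.XOp.X (n := n)))
      Unawareness.AwarenessValid ∧
    (∀ irr : Prop, Unawareness.SoundAndComplete
      (Unawareness.S5Provable (Φ := Φ) (Unawareness.XOp.X (n := n)) irr)
      Unawareness.AwarenessValid) := by
  have hK : Unawareness.WeaklyValid = Unawareness.AwModel.Valid (Unawareness.KOp.equiv n) :=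
    funext fun φ : Unawareness.LK n Φ => propext (Unawareness.weaklyValid_iff φ)
  have hX : Unawareness.AwarenessValid = Unawareness.AwModel.Valid (Unawareness.XOp.equiv n) :=
    funext fun φ : Unawareness.LX n Φ => propext (Unawareness.awarenessValid_iff φ)
  rw [hK, hX]
  exact ⟨Unawareness.AwModel.u_soundAndComplete (Unawareness.KOp.equiv n),
    Unawareness.AwModel.s5_soundAndComplete (Unawareness.KOp.equiv n),
    Unawareness.AwModel.u_soundAndComplete (Unawareness.XOp.equiv n),
    Unawareness.AwModel.s5_soundAndComplete (Unawareness.XOp.equiv n)⟩
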